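/- For a sequence $(c_k)_{k\ge 0}$ of complex numbers let $H_n(c_k)=\det(c_{i+j})_{0\le i,j\le n}$ $(n\ge 0)$. For a Dirichlet character $\chi$ modulo $q$ let the generalized Bernoulli numbers $B_{k,\chi}$ be defined by $$\sum_{a=1}^{q}\frac{\chi(a)\,t\,e^{at}}{e^{qt}-1}=\sum_{k=0}^{\infty}B_{k,\chi}\frac{t^k}{k!}.$$ For $q\in\{3,4,6\}$ let $\chi_q$ be the unique non-trivial Dirichlet character modulo $q$, so that $\chi_q(1)=1$, $\chi_q(q-1)=-1$, and $\chi_q(a)=0$ for all other residues $a$ modulo $q$. Then for all $q\in\{3,4,6\}$ and all integers $m\ge 0$, $$H_{2m}(B_{k,\chi_q})=0$$ and $$H_{2m+1}(B_{k,\chi_q})=(-1)^{m+1}\left(q^{m-1}(q-2)\right)^{2m+2}\prod_{\ell=1}^{m}\left(\frac{\ell^4\left((q-2)^2-(q\ell)^2\right)}{4(2\ell+1)(2\ell-1)}\right)^{2(m+1-\ell)}.$$ -/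

import Mathlib

/-- The `n`th Hankel determinant `det (c_{i+j})_{0 ≤ i, j ≤ n}` of the sequence `c`
(a determinant of order `n + 1`). -/
def hankelDet {R : Type*} [CommRing R] (n : ℕ) (c : ℕ → R) : R :=
  Matrix.det (Matrix.of fun i j : Fin (n + 1) => c ((i : ℕ) + (j : ℕ)))

/-- The formal power series `e^{a t}` in the variable `t = X`. -/
noncomputable def expSeries (a : ℂ) : PowerSeries ℂ :=
  PowerSeries.rescale a (PowerSeries.exp ℂ)

/-- The formal power series `(e^{q t} - 1) / t`, whose constant term is `q`. -/
noncomputable def expSubOneDiv (q : ℕ) : PowerSeries ℂ :=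
  PowerSeries.mk fun n => PowerSeries.coeff (n + 1) (expSeries (q : ℂ) - 1)

/-- The exponential generating series `∑_{a=1}^q χ(a) t e^{a t} / (e^{q t} - 1)`
attached to a Dirichlet character `χ` modulo `q`, with the common factor `t` cancelled.
See `genBernoulliSeries_mul` for the uncancelled form. -/
noncomputable def genBernoulliSeries {q : ℕ} (χ : DirichletCharacter ℂ q) : PowerSeries ℂ :=
  (∑ a ∈ Finset.Icc 1 q, PowerSeries.C (χ (a : ZMod q)) * expSeries (a : ℂ)) *
    (expSubOneDiv q)⁻¹

/-- The generalized Bernoulli number `B_{n,χ}` of a Dirichlet character `χ` modulo `q`, given by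
`∑_{a=1}^q χ(a) t e^{a t} / (e^{q t} - 1) = ∑_{n ≥ 0} B_{n,χ} t^n / n!`. -/
noncomputable def genBernoulli {q : ℕ} (χ : DirichletCharacter ℂ q) (n : ℕ) : ℂ :=
  (n.factorial : ℂ) * PowerSeries.coeff n (genBernoulliSeries χ)

theorem X_mul_expSubOneDiv (q : ℕ) :
    PowerSeries.X * expSubOneDiv q = expSeries (q : ℂ) - 1 := by
  ext n
  cases n with
  | zero =>
    rw [PowerSeries.coeff_zero_X_mul]
    simp [expSeries, -PowerSeries.coeff_zero_eq_constantCoeff_apply, PowerSeries.coeff_rescale,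
      PowerSeries.coeff_exp, -PowerSeries.coeff_zero_eq_constantCoeff]
  | succ n => simp [expSubOneDiv, PowerSeries.coeff_succ_X_mul]

/-- The defining identity of the generating series, with denominators cleared. -/
theorem genBernoulliSeries_mul {q : ℕ} (hq : q ≠ 0) (χ : DirichletCharacter ℂ q) :
    genBernoulliSeries χ * (expSeries (q : ℂ) - 1) =
      ∑ a ∈ Finset.Icc 1 q,
        PowerSeries.C (χ (a : ZMod q)) * PowerSeries.X * expSeries (a : ℂ) := by
  have h : PowerSeries.constantCoeff (expSubOneDiv q) ≠ 0 := by
    rw [← PowerSeries.coeff_zero_eq_constantCoeff_apply]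
    simp [expSubOneDiv, expSeries, PowerSeries.coeff_rescale, PowerSeries.coeff_exp,
      PowerSeries.coeff_one, hq]
  rw [← X_mul_expSubOneDiv, genBernoulliSeries]
  have h2 := PowerSeries.inv_mul_cancel _ h
  calc _ = (∑ a ∈ Finset.Icc 1 q, PowerSeries.C (χ (a : ZMod q)) * expSeries (a : ℂ)) *
        PowerSeries.X * ((expSubOneDiv q)⁻¹ * expSubOneDiv q) := by ring
    _ = _ := by
      rw [h2, mul_one, Finset.sum_mul]
      exact Finset.sum_congr rfl fun a _ => by ring

/-! Let `M` be the functional with moments $B_{k,\chi}$. The units modulo 3, 4 and 6 are only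
$\pm1$, so $\chi$ is odd, the generating series is odd, and the moments of even index vanish. The
Hankel matrix is therefore a checkerboard: its determinant is zero in odd size
(`hankelDet_even_eq_zero`), and in size $2m+2$ it is, up to sign, the square of the Hankel
determinant of the odd moments (`hankelDet_odd_eq`).

The generating series amounts to the difference equation $M(f(x+q))-M(f)=f'(1)-f'(q-1)$
(`momentFunctional_genBernoulli_comp_sub`). It evaluates $p\mapsto M(x\,p(x^2))$ on products of two
monic families, with roots $(q-1+qj)^2$ and $(1+qj)^2$; the value is a constant times $u_k
v_l/(k+l+1)$ (`oddFunctional_squareProd_mul`). Passing to monic families leaves the determinant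
unchanged (`det_functional_mul`), so what remains is a Hilbert determinant with scaled rows and
columns. -/

/-! ### Determinants -/

/-- The determinant of a matrix on `Fin (m + 1)`, expanded around its last diagonal entry. -/
theorem det_fin_succ_schur {K : Type*} [Field K] (m : ℕ) (f : ℕ → ℕ → K) (h : f m m ≠ 0) :
    (Matrix.of fun i j : Fin (m + 1) => f i j).det =
      f m m * (Matrix.of fun i j : Fin m => f i j - f i m * (f m m)⁻¹ * f m j).det := by
  let D : Matrix (Fin 1) (Fin 1) K := Matrix.of fun _ _ => f m m
  have hD : D * Matrix.of (fun _ _ => (f m m)⁻¹) = 1 := by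
    ext i j
    fin_cases i; fin_cases j
    simp [D, Matrix.mul_apply, h]
  let _ : Invertible D := ⟨_, mul_eq_one_comm.mp hD, hD⟩
  have hinv : ⅟D = Matrix.of (fun _ _ => (f m m)⁻¹) := invOf_eq_right_inv hD
  rw [← Matrix.det_submatrix_equiv_self finSumFinEquiv]
  have : (Matrix.of fun i j : Fin (m + 1) => f i j).submatrix finSumFinEquiv finSumFinEquiv =
      Matrix.fromBlocks (Matrix.of fun i j : Fin m => f i j) (Matrix.of fun i _ => f i m)
        (Matrix.of fun _ j => f m j) D := by
    ext i j
    rcases i with i | i <;> rcases j with j | j <;> simp [D]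
  rw [this, Matrix.det_fromBlocks₂₂, hinv]
  congr 1
  · simp [D]
  · congr 1
    ext i j
    simp [Matrix.mul_apply]

theorem det_mul_row_col {R ι : Type*} [CommRing R] [Fintype ι] [DecidableEq ι] (u v : ι → R)
    (A : Matrix ι ι R) :
    (Matrix.of fun i j => u i * v j * A i j).det = (∏ i, u i) * (∏ i, v i) * A.det := by
  have : (Matrix.of fun i j => u i * v j * A i j) =
      Matrix.of fun i j => u i * (Matrix.of fun i j => v j * A i j) i j := by
    ext i j; simp [mul_assoc]
  rw [this, Matrix.det_mul_column, Matrix.det_mul_row, mul_assoc]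

theorem prod_range_sub_div_add (m : ℕ) :
    ∏ i ∈ Finset.range m, (((m : ℂ) - i) / (m + i + 1)) =
      (m.factorial : ℂ) ^ 2 / (2 * m).factorial := by
  have h1 : ∏ i ∈ Finset.range m, ((m : ℂ) - i) = m.factorial := by
    rw [← Finset.prod_range_reflect, ← Finset.prod_range_add_one_eq_factorial, Nat.cast_prod]
    refine Finset.prod_congr rfl fun i hi => ?_
    have := Finset.mem_range.mp hi
    rw [Nat.cast_sub (by omega), Nat.cast_sub (by omega)]
    push_cast; ring
  have h2 : (m.factorial : ℂ) * ∏ i ∈ Finset.range m, ((m : ℂ) + i + 1) =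
      (2 * m).factorial := by
    rw [two_mul, ← Nat.factorial_mul_ascFactorial, Nat.ascFactorial_eq_prod_range]
    push_cast
    congr 1
    exact Finset.prod_congr rfl fun i _ => by ring
  have h3 : (m.factorial : ℂ) ≠ 0 := by exact_mod_cast m.factorial_ne_zero
  rw [Finset.prod_div_distrib, h1, ← h2]
  have h4 : ∏ i ∈ Finset.range m, ((m : ℂ) + i + 1) ≠ 0 := by
    refine Finset.prod_ne_zero_iff.mpr fun i _ => ?_
    norm_cast
  field_simp

/-- The recursion for the determinants of the Hilbert matrices. -/
theorem det_hilbert_succ (m : ℕ) :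
    (Matrix.of fun i j : Fin (m + 1) => 1 / ((i : ℂ) + j + 1)).det =
      ((m.factorial : ℂ) ^ 2 / (2 * m).factorial) ^ 2 / (2 * m + 1) *
        (Matrix.of fun i j : Fin m => 1 / ((i : ℂ) + j + 1)).det := by
  have key := det_fin_succ_schur m (fun i j => 1 / ((i : ℂ) + j + 1))
    (by rw [one_div]; apply inv_ne_zero; norm_cast)
  rw [key]
  -- The Schur complement of a Hilbert matrix is the smaller Hilbert matrix with rows and columns
  -- rescaled.
  have : (Matrix.of fun i j : Fin m => 1 / ((i : ℂ) + j + 1) -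
      1 / ((i : ℂ) + m + 1) * (1 / ((m : ℂ) + m + 1))⁻¹ * (1 / ((m : ℂ) + j + 1))) =
      Matrix.of fun i j : Fin m => (((m : ℂ) - i) / (m + i + 1)) * (((m : ℂ) - j) / (m + j + 1)) *
        (Matrix.of fun i j : Fin m => 1 / ((i : ℂ) + j + 1)) i j := by
    ext i j
    simp only [Matrix.of_apply]
    have h1 : (i : ℂ) + j + 1 ≠ 0 := by norm_cast
    have h2 : (i : ℂ) + m + 1 ≠ 0 := by norm_cast
    have h2' : (m : ℂ) + i + 1 ≠ 0 := by norm_cast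
    have h3 : (m : ℂ) + j + 1 ≠ 0 := by norm_cast
    have h4 : (m : ℂ) + m + 1 ≠ 0 := by norm_cast
    rw [show (m : ℂ) + i + 1 = i + m + 1 by ring]
    field_simp
    ring
  rw [this, det_mul_row_col, Fin.prod_univ_eq_prod_range (fun i => ((m : ℂ) - i) / (m + i + 1)) m,
    prod_range_sub_div_add, ← two_mul]
  ring

/-- A Hankel determinant of moments does not change when the powers are replaced by two families
of monic polynomials. -/
theorem det_functional_mul {R : Type*} [CommRing R] (n : ℕ) (L : Polynomial R →ₗ[R] R)
    (p r : ℕ → Polynomial R) (hp : ∀ i, (p i).Monic) (hr : ∀ i, (r i).Monic)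
    (hpd : ∀ i, (p i).natDegree = i) (hrd : ∀ i, (r i).natDegree = i) :
    (Matrix.of fun i j : Fin (n + 1) => L (p i * r j)).det =
      hankelDet n fun k => L (Polynomial.X ^ k) := by
  -- The outer factors are change-of-basis matrices, unitriangular because the polynomials are monic
  -- of degree `i`.
  have h : (Matrix.of fun i j : Fin (n + 1) => L (p i * r j)) =
      (Matrix.of fun i j : Fin (n + 1) => (p j).coeff i).transpose *
        (Matrix.of fun i j : Fin (n + 1) => L (Polynomial.X ^ ((i : ℕ) + (j : ℕ)))) *
        Matrix.of fun i j : Fin (n + 1) => (r j).coeff i := by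
    ext i j
    have hs : ∀ (p : ℕ → Polynomial R) (_ : ∀ i, (p i).natDegree = i) (i : Fin (n + 1)),
        p i = ∑ k : Fin (n + 1), Polynomial.C ((p i).coeff k) * Polynomial.X ^ (k : ℕ) := by
      intro p hpd i
      rw [Fin.sum_univ_eq_sum_range
        (fun k => Polynomial.C ((p i).coeff k) * Polynomial.X ^ k) (n + 1)]
      exact (p i).as_sum_range_C_mul_X_pow' (by rw [hpd]; exact i.2)
    simp only [Matrix.mul_apply, Matrix.of_apply, Matrix.transpose_apply, Finset.sum_mul]
    conv_lhs => rw [hs p hpd i, hs r hrd j, Finset.sum_mul_sum, Finset.sum_comm]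
    simp only [map_sum]
    refine Finset.sum_congr rfl fun k _ => Finset.sum_congr rfl fun l _ => ?_
    rw [show Polynomial.C ((p i).coeff l) * Polynomial.X ^ (l : ℕ) *
        (Polynomial.C ((r j).coeff k) * Polynomial.X ^ (k : ℕ)) =
        ((p i).coeff l * (r j).coeff k) • (Polynomial.X ^ ((l : ℕ) + (k : ℕ)) : Polynomial R) by
      rw [Polynomial.smul_eq_C_mul, Polynomial.C_mul, pow_add]; ring]
    rw [map_smul, smul_eq_mul]
    ring
  rw [h, Matrix.det_mul, Matrix.det_mul, Matrix.det_transpose,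
    Matrix.det_matrixOfPolynomials _ (fun i => hpd i) (fun i => hp i),
    Matrix.det_matrixOfPolynomials _ (fun i => hrd i) (fun i => hr i), one_mul, mul_one, hankelDet]

/-- Hankel determinants of odd order vanish when the terms of even index do. -/
theorem hankelDet_even_eq_zero (c : ℕ → ℂ) (hc : ∀ n, c (2 * n) = 0) (m : ℕ) :
    hankelDet (2 * m) c = 0 := by
  have h := det_mul_row_col (fun i : Fin (2 * m + 1) => (-1 : ℂ) ^ (i : ℕ))
    (fun i : Fin (2 * m + 1) => (-1 : ℂ) ^ (i : ℕ))
    (Matrix.of fun i j : Fin (2 * m + 1) => c ((i : ℕ) + (j : ℕ)))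
  -- Scaling row and column `i` by $(-1)^i$ negates the matrix, since only entries with $i+j$ odd
  -- survive; the odd size then gives det = -det.
  have h2 : (Matrix.of fun i j : Fin (2 * m + 1) => (-1 : ℂ) ^ (i : ℕ) * (-1 : ℂ) ^ (j : ℕ) *
      (Matrix.of fun i j : Fin (2 * m + 1) => c ((i : ℕ) + (j : ℕ))) i j) =
      -(Matrix.of fun i j : Fin (2 * m + 1) => c ((i : ℕ) + (j : ℕ))) := by
    ext i j
    simp only [Matrix.of_apply, Matrix.neg_apply, ← pow_add]
    rcases Nat.even_or_odd' ((i : ℕ) + (j : ℕ)) with ⟨k, hk | hk⟩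
    · rw [hk, hc]; simp
    · rw [hk, pow_succ, pow_mul]; simp
  rw [h2, Matrix.det_neg, Fintype.card_fin, pow_succ, pow_mul] at h
  have h3 : (∏ i : Fin (2 * m + 1), (-1 : ℂ) ^ (i : ℕ)) *
      (∏ i : Fin (2 * m + 1), (-1 : ℂ) ^ (i : ℕ)) = 1 := by
    rw [← Finset.prod_mul_distrib]
    exact Finset.prod_eq_one fun i _ => by rw [← mul_pow]; simp
  rw [h3] at h
  rw [hankelDet]
  norm_num at h
  linear_combination (-1 / 2 : ℂ) * h

theorem det_fromBlocks_zero_self_self {R ι : Type*} [CommRing R] [Fintype ι] [DecidableEq ι]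
    (A : Matrix ι ι R) :
    (Matrix.fromBlocks 0 A A 0).det = (-1) ^ Fintype.card ι * A.det ^ 2 := by
  have h1 : Matrix.fromBlocks 0 A A 0 =
      Matrix.fromBlocks A 0 0 A * Matrix.fromBlocks 0 1 1 0 := by
    simp [Matrix.fromBlocks_multiply]
  have h2 : (Matrix.fromBlocks 0 1 1 0 : Matrix (ι ⊕ ι) (ι ⊕ ι) R).det =
      (-1) ^ Fintype.card ι := by
    -- A unipotent factor puts an identity in the upper left corner, whose Schur complement is `-1`.
    have h3 : Matrix.fromBlocks 1 1 0 1 * Matrix.fromBlocks 0 1 1 0 =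
        (Matrix.fromBlocks 1 1 1 0 : Matrix (ι ⊕ ι) (ι ⊕ ι) R) := by
      simp [Matrix.fromBlocks_multiply]
    have h4 := congrArg Matrix.det h3
    rw [Matrix.det_mul, Matrix.det_fromBlocks_zero₂₁, Matrix.det_fromBlocks_one₁₁] at h4
    simpa [Matrix.det_neg] using h4
  rw [h1, Matrix.det_mul, h2, Matrix.det_fromBlocks_zero₂₁]
  ring

/-- Hankel determinants of even order of a sequence whose terms of even index vanish. -/
theorem hankelDet_odd_eq (c : ℕ → ℂ) (hc : ∀ n, c (2 * n) = 0) (m : ℕ) :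
    hankelDet (2 * m + 1) c = (-1) ^ (m + 1) * hankelDet m (fun k => c (2 * k + 1)) ^ 2 := by
  -- Even indices are listed first, then odd ones, so that both diagonal blocks vanish.
  let f : Fin (m + 1) ⊕ Fin (m + 1) → Fin (2 * m + 1 + 1) :=
    Sum.elim (fun i => ⟨2 * i, by omega⟩) (fun i => ⟨2 * i + 1, by omega⟩)
  have hf : Function.Bijective f := by
    rw [Fintype.bijective_iff_injective_and_card]
    constructor
    · rintro (i | i) (j | j) h <;> simp [f, Fin.ext_iff] at h ⊢ <;> omega
    · simp; omega
  rw [hankelDet, ← Matrix.det_submatrix_equiv_self (Equiv.ofBijective f hf)]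
  have : (Matrix.of fun i j : Fin (2 * m + 1 + 1) => c ((i : ℕ) + (j : ℕ))).submatrix
      (Equiv.ofBijective f hf) (Equiv.ofBijective f hf) =
      Matrix.fromBlocks 0 (Matrix.of fun i j : Fin (m + 1) => c (2 * ((i : ℕ) + (j : ℕ)) + 1))
        (Matrix.of fun i j : Fin (m + 1) => c (2 * ((i : ℕ) + (j : ℕ)) + 1)) 0 := by
    ext i j
    rcases i with i | i <;> rcases j with j | j <;> simp [f]
    · rw [← mul_add, hc]
    · congr 1; ring
    · congr 1; ring
    · rw [show 2 * (i : ℕ) + 1 + (2 * j + 1) = 2 * (i + j + 1) by ring, hc]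
  rw [this, det_fromBlocks_zero_self_self, Fintype.card_fin, hankelDet]

/-! ### The moment functional -/

section Functional

open Polynomial

/-- The linear functional on polynomials with moments `c`. -/
noncomputable def momentFunctional (c : ℕ → ℂ) : ℂ[X] →ₗ[ℂ] ℂ :=
  Polynomial.lsum fun n => c n • LinearMap.id

theorem momentFunctional_monomial (c : ℕ → ℂ) (n : ℕ) (a : ℂ) :
    momentFunctional c (monomial n a) = a * c n := by
  simp [momentFunctional, mul_comm]

theorem momentFunctional_X_pow (c : ℕ → ℂ) (n : ℕ) : momentFunctional c (X ^ n) = c n := by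
  rw [← monomial_one_right_eq_X_pow, momentFunctional_monomial, one_mul]

/-- `p ↦ M (X * p(X ^ 2))`. -/
noncomputable def oddFunctional (M : ℂ[X] →ₗ[ℂ] ℂ) : ℂ[X] →ₗ[ℂ] ℂ where
  toFun p := M (X * p.comp (X ^ 2))
  map_add' p r := by simp [mul_add]
  map_smul' a p := by
    simp [smul_comp]

theorem oddFunctional_apply (M : ℂ[X] →ₗ[ℂ] ℂ) (p : ℂ[X]) :
    oddFunctional M p = M (X * p.comp (X ^ 2)) := rfl

/-- `∏_{j < k} (X - (s + q j) ^ 2)`. -/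
noncomputable def squareProd (q s : ℂ) (k : ℕ) : ℂ[X] :=
  ∏ j ∈ Finset.range k, (X - C ((s + q * j) ^ 2))

/-- `∏_{j < k} (X - (s + q j))`. -/
noncomputable def linearProd (q s : ℂ) (k : ℕ) : ℂ[X] :=
  ∏ j ∈ Finset.range k, (X - C (s + q * j))

/-- `∏_{j < k} (-q (j + 1) (q (j + 1) + r))`. -/
noncomputable def risingWeight (q r : ℂ) (k : ℕ) : ℂ :=
  ∏ j ∈ Finset.range k, (-(q * (j + 1) * (q * (j + 1) + r)))

theorem squareProd_succ (q s : ℂ) (k : ℕ) :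
    squareProd q s (k + 1) = squareProd q s k * (X - C ((s + q * k) ^ 2)) :=
  Finset.prod_range_succ _ _

theorem linearProd_succ (q s : ℂ) (k : ℕ) :
    linearProd q s (k + 1) = linearProd q s k * (X - C (s + q * k)) :=
  Finset.prod_range_succ _ _

theorem linearProd_succ' (q s : ℂ) (k : ℕ) :
    linearProd q s (k + 1) = linearProd q (s + q) k * (X - C s) := by
  rw [linearProd, Finset.prod_range_succ', linearProd]
  congr 1
  · refine Finset.prod_congr rfl fun j _ => ?_
    push_cast
    rw [show s + q * ((j : ℂ) + 1) = s + q + q * j by ring]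
  · simp

theorem risingWeight_succ (q r : ℂ) (k : ℕ) :
    risingWeight q r (k + 1) = risingWeight q r k * (-(q * (k + 1) * (q * (k + 1) + r))) :=
  Finset.prod_range_succ _ _

theorem linearProd_comp_add (q s u : ℂ) (k : ℕ) :
    (linearProd q s k).comp (X + C u) = linearProd q (s - u) k := by
  rw [linearProd, Polynomial.prod_comp, linearProd]
  refine Finset.prod_congr rfl fun j _ => ?_
  rw [sub_comp, X_comp, C_comp, C_add, C_add, C_sub]
  ring

theorem squareProd_monic (q s : ℂ) (k : ℕ) : (squareProd q s k).Monic :=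
  monic_prod_of_monic _ _ fun _ _ => monic_X_sub_C _

theorem squareProd_natDegree (q s : ℂ) (k : ℕ) : (squareProd q s k).natDegree = k := by
  rw [squareProd, natDegree_prod_of_monic _ _ fun _ _ => monic_X_sub_C _]
  simp only [natDegree_X_sub_C, Finset.sum_const, Finset.card_range, smul_eq_mul, mul_one]

theorem squareProd_comp_sq (q s : ℂ) (k : ℕ) :
    (squareProd q s k).comp (X ^ 2) = linearProd q s k * linearProd (-q) (-s) k := by
  rw [squareProd, Polynomial.prod_comp, linearProd, linearProd, ← Finset.prod_mul_distrib]
  refine Finset.prod_congr rfl fun j _ => ?_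
  rw [sub_comp, X_comp, C_comp]
  simp only [C_add, C_mul, C_neg, C_pow]
  ring

theorem eval_derivative_mul_X_sub_C (p : ℂ[X]) (a : ℂ) :
    (derivative (p * (X - C a))).eval a = p.eval a := by
  simp [derivative_mul]

theorem prod_range_eval_linearProd (q s a : ℂ) (k : ℕ) :
    (linearProd q s k).eval a = ∏ j ∈ Finset.range k, (a - (s + q * j)) := by
  simp [linearProd, eval_prod]

variable {q : ℂ} {M : ℂ[X] →ₗ[ℂ] ℂ}

/-- The difference equation is applied to a product of linear factors whose roots form two
progressions of step `q`. Shifting by `q` changes only one root of each, so the difference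
telescopes to a multiple of $x\,P_k(x^2)$, with $P_k$ the given `squareProd`. -/
theorem oddFunctional_squareProd (hq : q ≠ 0)
    (hM : ∀ f : ℂ[X], M (f.comp (X + C q)) - M f =
      (derivative f).eval 1 - (derivative f).eval (q - 1)) (k : ℕ) :
    oddFunctional M (squareProd q (q - 1) k) =
      -((q - 2) / q) * risingWeight q (q - 2) k / (k + 1) := by
  set A := linearProd (-q) (-(q - 1)) k with hA
  set B := linearProd q (q - 1) k with hB
  have h1 : linearProd (-q) 1 (k + 1) = A * (X - C 1) := by
    rw [linearProd_succ', show (1 : ℂ) + -q = -(q - 1) by ring]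
  have h2 : linearProd q (q - 1) (k + 1) = B * (X - C (q - 1 + q * k)) := linearProd_succ _ _ _
  have h3 : linearProd (-q) (1 - q) (k + 1) = A * (X - C (1 - q + -q * k)) := by
    rw [linearProd_succ, show 1 - q = -(q - 1) by ring]
  have h4 : linearProd q (q - 1 - q) (k + 1) = B * (X - C (-1)) := by
    rw [linearProd_succ', show q - 1 - q + q = q - 1 by ring, show q - 1 - q = -1 by ring]
  have key := hM (linearProd (-q) 1 (k + 1) * linearProd q (q - 1) (k + 1))
  rw [mul_comp, linearProd_comp_add, linearProd_comp_add, ← map_sub] at key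
  -- Both 1 and `q - 1` are roots, so each derivative value is the product of the remaining factors.
  have e1 : (derivative (linearProd (-q) 1 (k + 1) * linearProd q (q - 1) (k + 1))).eval 1 =
      A.eval 1 * (linearProd q (q - 1) (k + 1)).eval 1 := by
    rw [h1, mul_right_comm, eval_derivative_mul_X_sub_C, eval_mul]
  have e2 : (derivative (linearProd (-q) 1 (k + 1) * linearProd q (q - 1) (k + 1))).eval (q - 1) =
      (linearProd (-q) 1 (k + 1)).eval (q - 1) * (linearProd q (q - 1 + q) k).eval (q - 1) := by
    rw [linearProd_succ' q, ← mul_assoc, eval_derivative_mul_X_sub_C, eval_mul]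
  have e3 : linearProd (-q) (1 - q) (k + 1) * linearProd q (q - 1 - q) (k + 1) -
      linearProd (-q) 1 (k + 1) * linearProd q (q - 1) (k + 1) =
      (2 * q * (k + 1)) • (X * (squareProd q (q - 1) k).comp (X ^ 2)) := by
    rw [h1, h2, h3, h4, squareProd_comp_sq, ← hA, ← hB, smul_eq_C_mul]
    simp only [C_add, C_sub, C_mul, C_neg, C_1, map_natCast, map_ofNat]
    ring
  have e4 : A.eval 1 * (linearProd q (q - 1) (k + 1)).eval 1 =
      -(q - 2) * risingWeight q (q - 2) k := by
    rw [linearProd_succ', eval_mul, hA, prod_range_eval_linearProd, prod_range_eval_linearProd,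
      ← mul_assoc, ← Finset.prod_mul_distrib, mul_comm]
    congr 1
    · simp; ring
    · exact Finset.prod_congr rfl fun j _ => by ring
  have e5 : (linearProd (-q) 1 (k + 1)).eval (q - 1) * (linearProd q (q - 1 + q) k).eval (q - 1) =
      (q - 2) * risingWeight q (q - 2) k := by
    rw [linearProd_succ', eval_mul, prod_range_eval_linearProd, prod_range_eval_linearProd,
      mul_right_comm, ← Finset.prod_mul_distrib, mul_comm]
    congr 1
    · simp; ring
    · exact Finset.prod_congr rfl fun j _ => by ring
  rw [e3, e1, e2, e4, e5, map_smul, smul_eq_mul, ← oddFunctional_apply] at key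
  have hk : (k : ℂ) + 1 ≠ 0 := by norm_cast
  field_simp
  linear_combination key / 2

theorem oddFunctional_squareProd_mul (hq : q ≠ 0)
    (hM : ∀ f : ℂ[X], M (f.comp (X + C q)) - M f =
      (derivative f).eval 1 - (derivative f).eval (q - 1)) (k l : ℕ) :
    oddFunctional M (squareProd q (q - 1) k * squareProd q 1 l) =
      -((q - 2) / q) * risingWeight q (q - 2) k * risingWeight q (-(q - 2)) l / (k + l + 1) := by
  induction l generalizing k with
  | zero => simpa [squareProd, risingWeight] using oddFunctional_squareProd hq hM k
  | succ l ih =>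
    -- The new factors for `k` and `l` differ by the constant $(q-1+qk)^2-(1+ql)^2$, which splits as
    -- a difference of squares.
    have h : squareProd q (q - 1) k * squareProd q 1 (l + 1) =
        squareProd q (q - 1) (k + 1) * squareProd q 1 l +
          (q * (k + l + 1) * (q - 2 + q * (k - l))) •
            (squareProd q (q - 1) k * squareProd q 1 l) := by
      rw [squareProd_succ, squareProd_succ, smul_eq_C_mul]
      simp only [C_add, C_sub, C_mul, C_pow, C_1, map_natCast, map_ofNat]
      ring
    rw [h, map_add, map_smul, ih, ih, risingWeight_succ, risingWeight_succ, smul_eq_mul]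
    have h1 : (k : ℂ) + l + 1 ≠ 0 := by norm_cast
    have h2 : (k : ℂ) + l + 1 + 1 ≠ 0 := by norm_cast
    push_cast
    rw [show (k : ℂ) + 1 + l + 1 = k + l + 1 + 1 by ring, ← add_assoc]
    field_simp
    ring

theorem hankelDet_oddFunctional (hq : q ≠ 0)
    (hM : ∀ f : ℂ[X], M (f.comp (X + C q)) - M f =
      (derivative f).eval 1 - (derivative f).eval (q - 1)) (m : ℕ) :
    hankelDet m (fun k => M (X ^ (2 * k + 1))) =
      (-((q - 2) / q)) ^ (m + 1) *
        ((∏ i ∈ Finset.range (m + 1), risingWeight q (q - 2) i * risingWeight q (-(q - 2)) i) *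
          (Matrix.of fun i j : Fin (m + 1) => 1 / ((i : ℂ) + j + 1)).det) := by
  have h := det_functional_mul m (oddFunctional M) (squareProd q (q - 1)) (squareProd q 1)
    (squareProd_monic _ _) (squareProd_monic _ _) (squareProd_natDegree _ _)
    (squareProd_natDegree _ _)
  have h1 : (fun k => M (X ^ (2 * k + 1))) = fun k => oddFunctional M (X ^ k) := by
    ext k
    rw [oddFunctional_apply, X_pow_comp, ← pow_mul, pow_succ']
  rw [h1, ← h]
  simp only [oddFunctional_squareProd_mul hq hM]
  have h2 : (Matrix.of fun i j : Fin (m + 1) => -((q - 2) / q) * risingWeight q (q - 2) i *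
      risingWeight q (-(q - 2)) j / ((i : ℂ) + j + 1)) =
      Matrix.of fun i j : Fin (m + 1) => (-((q - 2) / q) * risingWeight q (q - 2) i) *
      risingWeight q (-(q - 2)) j * (Matrix.of fun i j : Fin (m + 1) => 1 / ((i : ℂ) + j + 1)) i j := by
    ext i j
    simp [div_eq_mul_inv]
  rw [h2, det_mul_row_col (fun i : Fin (m + 1) => -((q - 2) / q) * risingWeight q (q - 2) i)
    (fun i : Fin (m + 1) => risingWeight q (-(q - 2)) i), Finset.prod_mul_distrib,
    Fin.prod_univ_eq_prod_range (risingWeight q (q - 2)),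
    Fin.prod_univ_eq_prod_range (risingWeight q (-(q - 2))), Finset.prod_mul_distrib]
  simp only [Finset.prod_const, Finset.card_univ, Fintype.card_fin]
  ring

end Functional

/-! ### Evaluation of the product -/

/-- The ratio of consecutive Hilbert determinants, as a product that merges factor by factor with
the `risingWeight` products. -/
theorem hilbert_ratio (m : ℕ) :
    ((m.factorial : ℂ) ^ 2 / (2 * m).factorial) ^ 2 / (2 * m + 1) =
      ∏ l ∈ Finset.range m,
        (((l : ℂ) + 1) ^ 2 / (4 * (2 * (l + 1) + 1) * (2 * (l + 1) - 1))) := by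
  induction m with
  | zero => simp
  | succ m ih =>
    rw [Finset.prod_range_succ, ← ih, show 2 * (m + 1) = 2 * m + 1 + 1 by ring,
      Nat.factorial_succ (2 * m + 1), Nat.factorial_succ (2 * m), Nat.factorial_succ m]
    have h0 : ((2 * m).factorial : ℂ) ≠ 0 := by exact_mod_cast (2 * m).factorial_ne_zero
    have h1 : (2 * (m : ℂ) + 1) ≠ 0 := by norm_cast
    have h2 : (2 * (m : ℂ) + 1 + 1) ≠ 0 := by norm_cast
    have h3 : (2 * ((m : ℂ) + 1) + 1) ≠ 0 := by norm_cast
    have h4 : (2 * ((m : ℂ) + 1) - 1) ≠ 0 := by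
      rw [show 2 * ((m : ℂ) + 1) - 1 = 2 * m + 1 by ring]; exact h1
    have h5 : (m : ℂ) + 1 ≠ 0 := by norm_cast
    push_cast
    rw [show 2 * ((m : ℂ) + 1) - 1 = 2 * m + 1 by ring,
      show (2 * (m : ℂ) + 1 + 1) = 2 * (m + 1) by ring]
    field_simp
    ring

/-- Raising `m` by one multiplies the left side by one copy of every factor with `l ≤ m`; hence the
exponents `m - l`. -/
theorem risingWeight_prod_mul_det_hilbert (q r : ℂ) (m : ℕ) :
    (∏ i ∈ Finset.range (m + 1), risingWeight q r i * risingWeight q (-r) i) *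
        (Matrix.of fun i j : Fin (m + 1) => 1 / ((i : ℂ) + j + 1)).det =
      ∏ l ∈ Finset.range m, (-(q ^ 2 * (((l : ℂ) + 1) ^ 4 * (r ^ 2 - (q * (l + 1)) ^ 2) /
        (4 * (2 * (l + 1) + 1) * (2 * (l + 1) - 1))))) ^ (m - l) := by
  induction m with
  | zero => simp [risingWeight]
  | succ m ih =>
    have h1 : risingWeight q r (m + 1) * risingWeight q (-r) (m + 1) *
        ((((m + 1).factorial : ℂ) ^ 2 / (2 * (m + 1)).factorial) ^ 2 / (2 * ((m + 1 : ℕ) : ℂ) + 1)) =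
        ∏ l ∈ Finset.range (m + 1), (-(q ^ 2 * (((l : ℂ) + 1) ^ 4 * (r ^ 2 - (q * (l + 1)) ^ 2) /
        (4 * (2 * (l + 1) + 1) * (2 * (l + 1) - 1))))) := by
      rw [hilbert_ratio, risingWeight, risingWeight, ← Finset.prod_mul_distrib,
        ← Finset.prod_mul_distrib]
      exact Finset.prod_congr rfl fun l _ => by ring
    have h2 : ∀ g : ℕ → ℂ, ∏ l ∈ Finset.range (m + 1), g l ^ (m + 1 - l) =
        (∏ l ∈ Finset.range m, g l ^ (m - l)) * ∏ l ∈ Finset.range (m + 1), g l := by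
      intro g
      have : ∏ l ∈ Finset.range m, g l ^ (m - l) = ∏ l ∈ Finset.range (m + 1), g l ^ (m - l) := by
        simp [Finset.prod_range_succ]
      rw [this, ← Finset.prod_mul_distrib]
      refine Finset.prod_congr rfl fun l hl => ?_
      have := Finset.mem_range.mp hl
      rw [← pow_succ]
      congr 1; omega
    rw [h2, ← ih, ← h1, det_hilbert_succ (m + 1), Finset.prod_range_succ]
    ring

/-- Squaring removes the signs, and the powers of `q` combine as $2m(m+1)-2(m+1)=(m-1)(2m+2)$. -/
theorem sq_prod_eq (q r : ℂ) (hq : q ≠ 0) (m : ℕ) :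
    ((-(r / q)) ^ (m + 1) *
      ∏ l ∈ Finset.range m, (-(q ^ 2 * (((l : ℂ) + 1) ^ 4 * (r ^ 2 - (q * (l + 1)) ^ 2) /
        (4 * (2 * (l + 1) + 1) * (2 * (l + 1) - 1))))) ^ (m - l)) ^ 2 =
    (q ^ ((m : ℤ) - 1) * r) ^ (2 * m + 2) *
        ∏ ℓ ∈ Finset.Icc 1 m,
          ((ℓ : ℂ) ^ 4 * (r ^ 2 - (q * (ℓ : ℂ)) ^ 2) /
            (4 * (2 * (ℓ : ℂ) + 1) * (2 * (ℓ : ℂ) - 1))) ^ (2 * (m + 1 - ℓ)) := by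
  have h1 : ∀ g : ℕ → ℂ, ∏ ℓ ∈ Finset.Icc 1 m, g ℓ = ∏ l ∈ Finset.range m, g (l + 1) := by
    intro g
    rw [Finset.range_eq_Ico, Finset.prod_Ico_add' g 0 m 1]
    rfl
  have h2 : ∏ l ∈ Finset.range m, (q ^ 2) ^ (m - l) = q ^ (m * (m + 1)) := by
    rw [← Finset.prod_range_reflect]
    rw [Finset.prod_congr rfl (g := fun l => (q ^ 2) ^ (l + 1)) fun l hl => by
      have := Finset.mem_range.mp hl
      congr 1; omega]
    induction m with
    | zero => simp
    | succ m ih =>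
      rw [Finset.prod_range_succ, ih fun g => by
        rw [Finset.range_eq_Ico, Finset.prod_Ico_add' g 0 m 1]; rfl]
      ring
  rw [h1, mul_pow, ← Finset.prod_pow]
  rw [Finset.prod_congr rfl (g := fun l : ℕ => ((q ^ 2) ^ (m - l)) ^ 2 *
    ((((l + 1 : ℕ) : ℂ)) ^ 4 * (r ^ 2 - (q * ((l + 1 : ℕ) : ℂ)) ^ 2) /
        (4 * (2 * ((l + 1 : ℕ) : ℂ) + 1) * (2 * ((l + 1 : ℕ) : ℂ) - 1))) ^
          (2 * (m + 1 - (l + 1)))) fun l _ => by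
    rw [← pow_mul, mul_comm (m - l) 2, pow_mul, neg_sq, ← pow_mul, mul_pow, pow_mul (q ^ 2) 2,
      ← pow_mul (q ^ 2), ← pow_mul (q ^ 2), mul_comm (m - l) 2, Nat.add_sub_add_right]
    push_cast
    rfl]
  rw [Finset.prod_mul_distrib, ← mul_assoc, Finset.prod_pow, h2]
  congr 1
  rw [zpow_sub₀ hq, zpow_natCast, zpow_one, ← pow_mul, mul_comm (m + 1) 2, mul_add_one,
    Even.neg_pow ⟨m + 1, by ring⟩, div_pow, mul_pow, div_pow]
  field_simp
  ring

/-! ### Generalized Bernoulli numbers of the odd characters -/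

section Bernoulli

variable {q : ℕ}

theorem coeff_expSeries (a : ℂ) (n : ℕ) :
    PowerSeries.coeff n (expSeries a) = a ^ n / n.factorial := by
  simp [expSeries, PowerSeries.coeff_rescale, PowerSeries.coeff_exp, div_eq_mul_inv]

theorem expSeries_mul (a b : ℂ) : expSeries a * expSeries b = expSeries (a + b) :=
  PowerSeries.exp_mul_exp_eq_exp_add a b

theorem expSeries_zero : expSeries 0 = 1 := by
  simp [expSeries]

theorem rescale_neg_one_expSeries (a : ℂ) :
    PowerSeries.rescale (-1) (expSeries a) = expSeries (-a) := by
  rw [expSeries, PowerSeries.rescale_rescale, mul_neg_one, expSeries]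

/-- A non-trivial character modulo `3`, `4` or `6` takes the value `-1` at `-1`. -/
theorem odd_of_ne_one (hq : q = 3 ∨ q = 4 ∨ q = 6) (χ : DirichletCharacter ℂ q) (hχ : χ ≠ 1) :
    χ.Odd := by
  refine χ.even_or_odd.resolve_left fun h => hχ ?_
  -- With no other units, an even character would be trivial.
  have hu : ∀ u : (ZMod q)ˣ, u = 1 ∨ u = -1 := by
    rcases hq with rfl | rfl | rfl <;> decide
  refine MulChar.ext fun u => ?_
  rcases hu u with rfl | rfl
  · simp
  · rw [MulChar.one_apply_coe, Units.val_neg, Units.val_one]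
    exact h

theorem genBernoulliSeries_mul_of_ne_one (hq : q = 3 ∨ q = 4 ∨ q = 6)
    (χ : DirichletCharacter ℂ q) (hχ : χ ≠ 1) :
    genBernoulliSeries χ * (expSeries (q : ℂ) - 1) =
      PowerSeries.X * (expSeries 1 - expSeries ((q : ℂ) - 1)) := by
  rw [genBernoulliSeries_mul (by omega) χ]
  have hodd : χ (-1) = -1 := odd_of_ne_one hq χ hχ
  have h0 : ∀ a : ZMod q, ¬ IsUnit a → χ a = 0 := fun a ha => χ.map_nonunit ha
  rcases hq with rfl | rfl | rfl
  · have h2 : χ (2 : ZMod 3) = -1 := hodd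
    have h3 : χ (3 : ZMod 3) = 0 := h0 3 (by decide)
    simp only [Finset.sum_Icc_succ_top, Nat.reduceAdd, Nat.reduceLeDiff, Finset.Icc_self,
      Finset.sum_singleton, Nat.cast_one, Nat.cast_ofNat, map_one, h2, h3, map_neg, map_zero]
    norm_num
    ring
  · have h2 : χ (2 : ZMod 4) = 0 := h0 2 (by decide)
    have h3 : χ (3 : ZMod 4) = -1 := hodd
    have h4 : χ (4 : ZMod 4) = 0 := h0 4 (by decide)
    simp only [Finset.sum_Icc_succ_top, Nat.reduceAdd, Nat.reduceLeDiff, Finset.Icc_self,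
      Finset.sum_singleton, Nat.cast_one, Nat.cast_ofNat, map_one, h2, h3, h4, map_neg, map_zero]
    norm_num
    ring
  · have h2 : χ (2 : ZMod 6) = 0 := h0 2 (by decide)
    have h3 : χ (3 : ZMod 6) = 0 := h0 3 (by decide)
    have h4 : χ (4 : ZMod 6) = 0 := h0 4 (by decide)
    have h5 : χ (5 : ZMod 6) = -1 := hodd
    have h6 : χ (6 : ZMod 6) = 0 := h0 6 (by decide)
    simp only [Finset.sum_Icc_succ_top, Nat.reduceAdd, Nat.reduceLeDiff, Finset.Icc_self,
      Finset.sum_singleton, Nat.cast_one, Nat.cast_ofNat, map_one, h2, h3, h4, h5, h6, map_neg,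
      map_zero]
    norm_num
    ring

variable {χ : DirichletCharacter ℂ q}

theorem genBernoulli_two_mul (hq : q ≠ 0)
    (hχ : genBernoulliSeries χ * (expSeries (q : ℂ) - 1) =
      PowerSeries.X * (expSeries 1 - expSeries ((q : ℂ) - 1))) (n : ℕ) :
    genBernoulli χ (2 * n) = 0 := by
  have hne : expSeries (q : ℂ) - 1 ≠ 0 := by
    intro h
    have := congrArg (PowerSeries.coeff 1) h
    rw [map_sub, coeff_expSeries, PowerSeries.coeff_one] at this
    simp [hq] at this
  -- Substitute $t\mapsto -t$, multiply by $e^{qt}$, and cancel $e^{qt}-1$.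
  have hF : PowerSeries.rescale (-1) (genBernoulliSeries χ) = -genBernoulliSeries χ := by
    have h := congrArg (PowerSeries.rescale (-1 : ℂ)) hχ
    simp only [map_mul, map_sub, rescale_neg_one_expSeries, map_one,
      PowerSeries.rescale_neg_one_X] at h
    have h1 := expSeries_mul (q : ℂ) (-q)
    have h2 := expSeries_mul (q : ℂ) (-1)
    have h3 := expSeries_mul (q : ℂ) (-((q : ℂ) - 1))
    rw [add_neg_cancel, expSeries_zero] at h1
    rw [← sub_eq_add_neg] at h2
    rw [show (q : ℂ) + -((q : ℂ) - 1) = 1 by ring] at h3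
    refine mul_right_cancel₀ hne ?_
    linear_combination (-expSeries (q : ℂ)) * h + hχ +
      (PowerSeries.rescale (-1) (genBernoulliSeries χ)) * h1 + PowerSeries.X * (h2 - h3)
  have h := congrArg (PowerSeries.coeff (2 * n)) hF
  rw [PowerSeries.coeff_rescale, pow_mul, map_neg] at h
  norm_num at h
  rw [genBernoulli]
  linear_combination ((2 * n).factorial : ℂ) / 2 * h

open Polynomial in
theorem momentFunctional_genBernoulli_comp_sub
    (hχ : genBernoulliSeries χ * (expSeries (q : ℂ) - 1) =
      PowerSeries.X * (expSeries 1 - expSeries ((q : ℂ) - 1))) (f : ℂ[X]) :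
    momentFunctional (genBernoulli χ) (f.comp (X + C (q : ℂ))) -
        momentFunctional (genBernoulli χ) f =
      (derivative f).eval 1 - (derivative f).eval ((q : ℂ) - 1) := by
  induction f using Polynomial.induction_on' with
  | add f g hf hg =>
    simp only [add_comp, map_add, eval_add]
    linear_combination hf + hg
  | monomial n a =>
    -- On $x^n$ the claim is $n!$ times the coefficient of $t^n$ in the generating identity:
    -- multiplying by $e^{qt}$ shifts the argument by `q`, and the factor $t$ produces the
    -- derivative.
    have h := congrArg (fun F => (n.factorial : ℂ) * PowerSeries.coeff n F) hχ
    simp only [mul_sub, mul_one, map_sub] at h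
    have h1 : (n.factorial : ℂ) *
        PowerSeries.coeff n (genBernoulliSeries χ * expSeries (q : ℂ)) =
        momentFunctional (genBernoulli χ) ((X + C (q : ℂ)) ^ n) := by
      rw [(Commute.all (X : ℂ[X]) (C (q : ℂ))).add_pow', map_sum, PowerSeries.coeff_mul,
        Finset.mul_sum]
      refine Finset.sum_congr rfl fun ij hij => ?_
      obtain ⟨i, j⟩ := ij
      obtain rfl : i + j = n := Finset.HasAntidiagonal.mem_antidiagonal.mp hij
      simp only
      rw [← C_pow, mul_comm (X ^ i), ← smul_eq_C_mul, map_nsmul, map_smul,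
        momentFunctional_X_pow, coeff_expSeries, genBernoulli,
        ← Nat.add_choose_mul_factorial_mul_factorial]
      have hj : (j.factorial : ℂ) ≠ 0 := by exact_mod_cast j.factorial_ne_zero
      simp only [nsmul_eq_mul, smul_eq_mul, Nat.cast_mul]
      rw [Nat.choose_symm_add]
      field_simp
    have h2 : ∀ b : ℂ, (n.factorial : ℂ) * PowerSeries.coeff n (PowerSeries.X * expSeries b) =
        n * b ^ (n - 1) := by
      intro b
      cases n with
      | zero => simp
      | succ n =>
        rw [PowerSeries.coeff_succ_X_mul, coeff_expSeries, Nat.factorial_succ]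
        have hj : (n.factorial : ℂ) ≠ 0 := by exact_mod_cast n.factorial_ne_zero
        simp only [Nat.cast_mul, Nat.add_sub_cancel]
        field_simp
    rw [h1, h2, h2, ← genBernoulli] at h
    rw [monomial_comp, ← smul_eq_C_mul, map_smul, momentFunctional_monomial, derivative_monomial,
      eval_monomial, eval_monomial, smul_eq_mul]
    linear_combination a * h

end Bernoulli

/-- `χ ≠ 1` singles out the unique non-trivial Dirichlet character modulo `q` (`q = 3, 4, 6`),
which has `χ(1) = 1`, `χ(q - 1) = -1` and vanishes at all other residues. -/
theorem corollary3p5 (q : ℕ) (hq : q = 3 ∨ q = 4 ∨ q = 6)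
    (χ : DirichletCharacter ℂ q) (hχ : χ ≠ 1) (m : ℕ) :
    hankelDet (2 * m) (genBernoulli χ) = 0 ∧
    hankelDet (2 * m + 1) (genBernoulli χ) =
      (-1 : ℂ) ^ (m + 1) * ((q : ℂ) ^ ((m : ℤ) - 1) * ((q : ℂ) - 2)) ^ (2 * m + 2) *
        ∏ ℓ ∈ Finset.Icc 1 m,
          ((ℓ : ℂ) ^ 4 * (((q : ℂ) - 2) ^ 2 - ((q : ℂ) * (ℓ : ℂ)) ^ 2) /
            (4 * (2 * (ℓ : ℂ) + 1) * (2 * (ℓ : ℂ) - 1))) ^ (2 * (m + 1 - ℓ)) := by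
  have hF := genBernoulliSeries_mul_of_ne_one hq χ hχ
  have hq0 : q ≠ 0 := by omega
  have hqC : (q : ℂ) ≠ 0 := by exact_mod_cast hq0
  have heven := genBernoulli_two_mul hq0 hF
  refine ⟨hankelDet_even_eq_zero _ heven m, ?_⟩
  have h := hankelDet_oddFunctional hqC (momentFunctional_genBernoulli_comp_sub hF) m
  simp only [momentFunctional_X_pow] at h
  rw [hankelDet_odd_eq _ heven, h, risingWeight_prod_mul_det_hilbert, sq_prod_eq _ _ hqC, mul_assoc]
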